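/- For a subset $A$ of a field write $A+A=\{x+y : x,y\in A\}$ and $A+A^2=\{x+y^2 : x,y\in A\}$. There is an absolute constant $C>0$ such that the following holds. Let $\mathbb{F}_q$ be any finite field and let $A\subset\mathbb{F}_q$. Suppose that for every subfield $G$ of $\mathbb{F}_q$ (including the prime field and $\mathbb{F}_q$ itself), every $a\in\mathbb{F}_q\setminus\{0\}$ and every $b\in\mathbb{F}_q$, $$|(A+A)\cap(aG+b)|\le |G|^{1/2},\qquad\text{where } aG+b=\{ag+b : g\in G\}.$$ Then $$|A+A^2|\ge C\,|A|^{1+\frac{1}{84}}.$$ -/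

import Mathlib

open scoped Pointwise

/-- The set of squares `{x ^ 2 : x ∈ A}` of the elements of `A`
(not the pointwise product set of `A` with itself). -/
def squaresOf {F : Type*} [Field F] (A : Set F) : Set F :=
  {y : F | ∃ x ∈ A, y = x ^ 2}

/-- The affine copy `a G + b = {a * g + b : g ∈ G}` of a subfield `G` of `F`. -/
def affineCopy {F : Type*} [Field F] (G : Subfield F) (a b : F) : Set F :=
  {y : F | ∃ g ∈ G, y = a * g + b}

/-!
Write `n = |A|`, let `B` be the set of squares of `A`, and let `K = |A + B| / n`. The proof bounds `n`
by a constant times `K ^ 48`, which is stronger than the exponent `84` that is needed.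

*Few sums.* The Plünnecke–Ruzsa inequality gives `|A + A| ≤ 2 K² n` and `|m B - m B| ≤ K ^ (2 m) n`.
Call `s ∈ A + A` popular if `P = A ∩ (s - A)` has at least `n / (4 K²)` elements. For `u ∈ P` the
identity `2 s u - s² = u² - (s - u)²` puts `2 s P` into a translate of `B - B`, and Ruzsa's covering
lemma then covers `2 s A` by `8 K⁴` translates of `2 B - 2 B`
(`isCoveredBy_dilate_of_popular_sum`). So sums and differences of boundedly many dilates `2 s A`,
with `s` popular, have size at most a constant times `K ^ O(1) n`.

*Many sums.* By `exists_translate_of_popular_sums`, some `y ∈ A` and some `A' ⊆ A` with at least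
`n / 2` elements are such that `Y = A' + y` consists of popular sums. Let `R` be the set of quotients
`(a - b) / (c - d)` of differences of `Y`. If `r ∉ R`, then `|Y + r Y| = |Y|²`. If `R` is closed
under `ρ ↦ 1 + ρ` and under `ρ ↦ (s / t) ρ` for nonzero `s, t ∈ Y`, then `R` contains the subfield
`G` generated by the quotients `s / t`. Since `Y` lies in a dilate of `G`, the hypothesis on `A + A`
says `|G| ≥ |Y|²`, and averaging over `r ∈ G` produces `r ∈ R` with `|Y + r Y| ≥ |Y|² / 2`. In all
cases `exists_card_sq_le_two_mul_card_add_smul_of_differences` gives an `r` of one of the forms `ρ`,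
`1 + ρ`, `(s / t) ρ` with `ρ ∈ R` and `|Y + r Y| ≥ |Y|² / 2`. For each of these forms, clearing
denominators and applying the covering bound (with a triangle inequality for the third) shows
`|Y + r Y| ≤ 2 ^ 19 K ^ 48 n`, and comparing the two bounds finishes the proof.

In characteristic `2` the factor `2 s` is useless, but there the hypothesis for the prime field forces
`|A| ≤ 1`.
-/

/-! ### Dilates with large sumsets and the pivot argument -/

open Finset in
theorem card_sq_le_card_image_mul_card_collisions {α β : Type*} [DecidableEq α] [DecidableEq β]
    (s : Finset α) (f : α → β) :
    #s ^ 2 ≤ #(s.image f) * #{p ∈ s ×ˢ s | f p.1 = f p.2} := by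
  have hcol : #{p ∈ s ×ˢ s | f p.1 = f p.2} = ∑ b ∈ s.image f, #{a ∈ s | f a = b} ^ 2 := by
    rw [card_eq_sum_card_fiberwise (f := fun p => f p.1) (t := s.image f)]
    · refine sum_congr rfl fun b _ => ?_
      rw [sq, ← card_product]
      congr 1
      ext ⟨x, y⟩
      simp only [mem_filter, mem_product]
      constructor
      · rintro ⟨⟨⟨hx, hy⟩, hxy⟩, hb⟩
        exact ⟨⟨hx, hb⟩, hy, hxy.symm.trans hb⟩
      · rintro ⟨⟨hx, hb⟩, hy, hb'⟩
        exact ⟨⟨⟨hx, hy⟩, hb.trans hb'.symm⟩, hb⟩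
    · intro p hp
      simp only [coe_filter, mem_product, Set.mem_ofPred_eq] at hp
      exact mem_coe.2 (mem_image_of_mem f hp.1.1)
  rw [hcol, card_eq_sum_card_image f s]
  exact sq_sum_le_card_mul_sum_sq

open Finset in
theorem add_smul_eq_image {F : Type*} [Field F] [DecidableEq F] (Y : Finset F) (r : F) :
    Y + r • Y = (Y ×ˢ Y).image fun p => p.1 + r * p.2 := by
  ext x
  simp [mem_add, mem_smul_finset, and_assoc]

open Finset in
/-- Averaging over dilations: among at least `|Y| ^ 2` dilation factors there is one for which the
sum of `Y` and its dilate is of the largest possible order. -/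
theorem exists_card_sq_le_two_mul_card_add_smul {F : Type*} [Field F] [DecidableEq F]
    (T Y : Finset F) (hY : Y.Nonempty) (hT : #Y ^ 2 ≤ #T) : ∃ r ∈ T, #Y ^ 2 ≤ 2 * #(Y + r • Y) := by
  by_contra! hcon
  set Q : Finset ((F × F) × (F × F)) := (Y ×ˢ Y) ×ˢ (Y ×ˢ Y) with hQ
  let E : F → ((F × F) × (F × F)) → Prop := fun r p => p.1.1 + r * p.1.2 = p.2.1 + r * p.2.2
  have hYpos : 0 < #Y := hY.card_pos
  have hTpos : 0 < #T := lt_of_lt_of_le (by positivity) hT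
  have hlow : ∀ r ∈ T, 2 * #Y ^ 2 < #{p ∈ Q | E r p} := by
    intro r hr
    have h1 := card_sq_le_card_image_mul_card_collisions (Y ×ˢ Y) fun p : F × F => p.1 + r * p.2
    rw [← add_smul_eq_image, card_product] at h1
    have h2 := hcon r hr
    change (#Y * #Y) ^ 2 ≤ #(Y + r • Y) * #{p ∈ Q | E r p} at h1
    by_contra! h3
    have h4 : 0 < #Y ^ 2 := by positivity
    have h5 : #(Y + r • Y) * #{p ∈ Q | E r p} ≤ #(Y + r • Y) * (2 * #Y ^ 2) := by gcongr
    nlinarith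
  have hup : ∀ r, #{p ∈ Q | E r p} ≤ #Y ^ 2 + #{p ∈ Q | p.1.2 ≠ p.2.2 ∧ E r p} := by
    intro r
    have hsplit : {p ∈ Q | E r p} ⊆
        (Y ×ˢ Y).image (fun p : F × F => (p, p)) ∪ {p ∈ Q | p.1.2 ≠ p.2.2 ∧ E r p} := by
      rintro ⟨⟨a, c⟩, ⟨b, d⟩⟩ hp
      simp only [mem_filter, E, hQ, mem_product] at hp
      simp only [mem_union, mem_image, mem_filter, E, hQ, mem_product]
      by_cases hcd : c = d
      · subst hcd
        refine Or.inl ⟨(a, c), hp.1.1, ?_⟩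
        rw [add_right_cancel hp.2]
      · exact Or.inr ⟨hp.1, hcd, hp.2⟩
    calc _ ≤ _ := card_le_card hsplit
      _ ≤ _ := card_union_le _ _
      _ ≤ _ := by
        gcongr
        exact card_image_le.trans (by rw [card_product, sq])
  have hdiag : ∑ r ∈ T, #{p ∈ Q | p.1.2 ≠ p.2.2 ∧ E r p} ≤ #Q := by
    have := sum_card_bipartiteAbove_eq_sum_card_bipartiteBelow (s := T) (t := Q)
      (fun r p => p.1.2 ≠ p.2.2 ∧ E r p)
    simp only [bipartiteAbove, bipartiteBelow] at this
    rw [this, card_eq_sum_ones]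
    refine sum_le_sum fun p _ => card_le_one.2 fun r hr r' hr' => ?_
    simp only [mem_filter, E] at hr hr'
    obtain ⟨-, hne, h1⟩ := hr
    obtain ⟨-, -, h2⟩ := hr'
    have h3 : (r - r') * (p.1.2 - p.2.2) = 0 := by linear_combination h1 - h2
    rcases mul_eq_zero.1 h3 with h | h
    · exact sub_eq_zero.1 h
    · exact absurd (sub_eq_zero.1 h) hne
  have hQcard : #Q = #Y ^ 2 * #Y ^ 2 := by simp only [hQ, card_product]; ring
  have h1 : #T * (2 * #Y ^ 2) < ∑ r ∈ T, #{p ∈ Q | E r p} := by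
    rw [← smul_eq_mul, ← sum_const]
    exact sum_lt_sum_of_nonempty (card_pos.1 hTpos) hlow
  have h2 : ∑ r ∈ T, #{p ∈ Q | E r p} ≤ #T * #Y ^ 2 + #Q := by
    calc _ ≤ ∑ r ∈ T, (#Y ^ 2 + #{p ∈ Q | p.1.2 ≠ p.2.2 ∧ E r p}) := sum_le_sum fun r _ => hup r
      _ ≤ _ := by
        rw [sum_add_distrib, sum_const, smul_eq_mul]
        gcongr
  have h3 : #Q ≤ #T * #Y ^ 2 := by rw [hQcard]; gcongr
  linarith

/-- The set of quotients `(a - b) / (c - d)` of differences of elements of `Y`, with `c ≠ d`. -/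
def differenceQuotients {F : Type*} [Field F] (Y : Finset F) : Set F :=
  {r | ∃ a ∈ Y, ∃ b ∈ Y, ∃ c ∈ Y, ∃ d ∈ Y, c ≠ d ∧ r = (a - b) / (c - d)}

open Finset in
/-- A coincidence `a + r c = b + r d` with `c ≠ d` exhibits `r` as a quotient of differences. -/
theorem card_add_smul_of_notMem_differenceQuotients {F : Type*} [Field F] [DecidableEq F]
    {Y : Finset F} {r : F} (hr : r ∉ differenceQuotients Y) : #(Y + r • Y) = #Y ^ 2 := by
  rw [add_smul_eq_image, card_image_of_injOn, card_product, sq]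
  rintro ⟨a, c⟩ hac ⟨b, d⟩ hbd h
  simp only [coe_product, Set.mem_prod, mem_coe] at hac hbd h
  by_cases hcd : c = d
  · subst hcd
    rw [add_right_cancel h]
  · refine absurd ⟨b, hbd.1, a, hac.1, c, hac.2, d, hbd.2, hcd, ?_⟩ hr
    rw [eq_div_iff (sub_ne_zero.2 hcd)]
    linear_combination h

theorem neg_mem_differenceQuotients {F : Type*} [Field F] {Y : Finset F} {r : F}
    (hr : r ∈ differenceQuotients Y) :
    -r ∈ differenceQuotients Y := by
  obtain ⟨a, ha, b, hb, c, hc, d, hd, hcd, rfl⟩ := hr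
  exact ⟨b, hb, a, ha, c, hc, d, hd, hcd, by ring⟩

/-- A finite symmetric set that contains `0` and is closed under adding `1` and under multiplication
by the elements of `Z` contains the subfield generated by `Z`. The reason is that the
`g` with `g + R ⊆ R` form an additive group containing `1` which is stable under `Z`, hence under
the ring generated by `Z`; by finiteness this ring is a field. -/
theorem subfieldClosure_subset_of_one_add_mem_of_mul_mem {F : Type*} [Field F] [Finite F]
    {R Z : Set F} (h0 : 0 ∈ R)
    (hneg : ∀ r ∈ R, -r ∈ R) (hone : ∀ r ∈ R, 1 + r ∈ R) (hmul : ∀ z ∈ Z, ∀ r ∈ R, z * r ∈ R) :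
    (Subfield.closure Z : Set F) ⊆ R := by
  -- Multiplication by a nonzero `z` is injective, so it permutes a finite set that it preserves.
  have hdiv : ∀ (S : Set F) (z : F), z ≠ 0 → (∀ r ∈ S, z * r ∈ S) → ∀ r ∈ S, z⁻¹ * r ∈ S := by
    intro S z hz hS r hr
    have hsurj : Function.Surjective fun x : S => (⟨z * x, hS x x.2⟩ : S) :=
      Finite.injective_iff_surjective.1 fun x y h =>
        Subtype.ext (mul_left_cancel₀ hz (congrArg Subtype.val h))
    obtain ⟨x, hx⟩ := hsurj ⟨r, hr⟩
    have hx' : z * x = r := congrArg Subtype.val hx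
    rw [← hx', inv_mul_cancel_left₀ hz]
    exact x.2
  let S : Set F := {g | ∀ r ∈ R, g + r ∈ R}
  have hSneg : ∀ g ∈ S, -g ∈ S := fun g hg r hr => by
    simpa [add_comm] using hneg _ (hg _ (hneg r hr))
  have key : ∀ x ∈ Subfield.closure Z, ∀ g ∈ S, x * g ∈ S := by
    intro x hx
    induction hx using Subfield.closure_induction with
    | mem z hz =>
      intro g hg r hr
      rcases eq_or_ne z 0 with rfl | hz0
      · simpa using hr
      · have := hmul z hz _ (hg _ (hdiv R z hz0 (hmul z hz) r hr))
        rwa [mul_add, mul_inv_cancel_left₀ hz0] at this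
    | one => simp
    | add x y _ _ hx hy =>
      intro g hg r hr
      rw [add_mul, add_assoc]
      exact hx g hg _ (hy g hg r hr)
    | neg x _ hx =>
      intro g hg
      rw [neg_mul]
      exact hSneg _ (hx g hg)
    | inv x _ hx =>
      rcases eq_or_ne x 0 with rfl | hx0
      · simpa using hx
      · exact hdiv S x hx0 hx
    | mul x y _ _ hx hy =>
      intro g hg
      rw [mul_assoc]
      exact hx _ (hy g hg)
  intro x hx
  simpa using key x hx 1 hone 0 h0

open Finset in
/-- The pivot argument. Unless `Y` lies in a dilate of a subfield with fewer than `|Y| ^ 2`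
elements, some `r` of one of the forms `ρ`, `1 + ρ`, `(s / t) * ρ`, where
`ρ = (a - b) / (c - d)` is a quotient of differences of `Y` and `s, t ∈ Y`, makes `Y + r • Y` have
at least `|Y| ^ 2 / 2` elements. -/
theorem exists_card_sq_le_two_mul_card_add_smul_of_differences {F : Type*} [Field F]
    [DecidableEq F] [Finite F] {Y : Finset F}
    (hY : 1 < #Y)
    (hG : ∀ (G : Subfield F) (t : F), t ≠ 0 → (∀ y ∈ Y, ∃ g ∈ G, y = t * g) →
      #Y ^ 2 ≤ Nat.card G) :
    ∃ a ∈ Y, ∃ b ∈ Y, ∃ c ∈ Y, ∃ d ∈ Y, c ≠ d ∧ ∃ r : F, #Y ^ 2 ≤ 2 * #(Y + r • Y) ∧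
      (r = (a - b) / (c - d) ∨ r = 1 + (a - b) / (c - d) ∨
        ∃ s ∈ Y, ∃ t ∈ Y, s ≠ 0 ∧ t ≠ 0 ∧ r = s / t * ((a - b) / (c - d))) := by
  have hlarge : ∀ r ∉ differenceQuotients Y, #Y ^ 2 ≤ 2 * #(Y + r • Y) := fun r hr => by
    rw [card_add_smul_of_notMem_differenceQuotients hr]
    omega
  by_cases h1 : ∀ r ∈ differenceQuotients Y, 1 + r ∈ differenceQuotients Y
  swap
  · push Not at h1
    obtain ⟨r, ⟨a, ha, b, hb, c, hc, d, hd, hcd, rfl⟩, hr⟩ := h1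
    exact ⟨a, ha, b, hb, c, hc, d, hd, hcd, _, hlarge _ hr, Or.inr (Or.inl rfl)⟩
  by_cases h2 : ∀ s ∈ Y, ∀ t ∈ Y, s ≠ 0 → t ≠ 0 → ∀ r ∈ differenceQuotients Y,
      s / t * r ∈ differenceQuotients Y
  swap
  · push Not at h2
    obtain ⟨s, hs, t, ht, hs0, ht0, r, ⟨a, ha, b, hb, c, hc, d, hd, hcd, rfl⟩, hr⟩ := h2
    exact ⟨a, ha, b, hb, c, hc, d, hd, hcd, _, hlarge _ hr,
      Or.inr (Or.inr ⟨s, hs, t, ht, hs0, ht0, rfl⟩)⟩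
  obtain ⟨u, hu, v, hv, huv⟩ := one_lt_card.1 hY
  obtain ⟨t, ht, ht0⟩ : ∃ t ∈ Y, t ≠ 0 := by
    by_cases hu0 : u = 0
    · exact ⟨v, hv, fun hv0 => huv (hu0.trans hv0.symm)⟩
    · exact ⟨u, hu, hu0⟩
  have h0 : (0 : F) ∈ differenceQuotients Y := ⟨u, hu, u, hu, u, hu, v, hv, huv, by simp⟩
  set G : Subfield F := Subfield.closure ((fun s => s / t) '' (Y : Set F)) with hGdef
  have hGR : (G : Set F) ⊆ differenceQuotients Y := by
    refine subfieldClosure_subset_of_one_add_mem_of_mul_mem h0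
      (fun r => neg_mem_differenceQuotients) h1 ?_
    rintro _ ⟨s, hs, rfl⟩ r hr
    rcases eq_or_ne s 0 with rfl | hs0
    · simpa using h0
    · exact h2 s hs t ht hs0 ht0 r hr
  have hcard := hG G t ht0 fun y hy =>
    ⟨y / t, Subfield.subset_closure ⟨y, hy, rfl⟩, (mul_div_cancel₀ y ht0).symm⟩
  obtain ⟨r, hr, hcr⟩ := exists_card_sq_le_two_mul_card_add_smul
    (Set.toFinite (G : Set F)).toFinset Y (card_pos.1 (by omega))
    (by rwa [← Set.ncard_eq_toFinset_card, ← Nat.card_coe_set_eq])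
  obtain ⟨a, ha, b, hb, c, hc, d, hd, hcd, rfl⟩ := hGR ((Set.Finite.mem_toFinset _).1 hr)
  exact ⟨a, ha, b, hb, c, hc, d, hd, hcd, _, hcr, Or.inl rfl⟩

/-! ### Popular sums -/

open Finset in
/-- At least half of the pairs in `A × A` have a sum with at least half the average number of
representations; hence some translate of at least half of `A` consists of such popular sums. -/
theorem exists_translate_of_popular_sums {M : Type*} [AddCommGroup M] [DecidableEq M]
    (A : Finset M) (hA : A.Nonempty) :
    ∃ y ∈ A, ∃ A' ⊆ A, #A ≤ 2 * #A' ∧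
      ∀ x ∈ A', #A * #A ≤ 2 * #(A + A) * #{u ∈ A | x + y - u ∈ A} := by
  let good : M → Prop := fun s => #A * #A ≤ 2 * #(A + A) * #{u ∈ A | s - u ∈ A}
  have hAA : 0 < #(A + A) := (hA.add hA).card_pos
  have hrep : ∀ s, #{p ∈ A ×ˢ A | p.1 + p.2 = s} = #{u ∈ A | s - u ∈ A} := by
    intro s
    refine card_bij (fun p _ => p.1) ?_ ?_ ?_
    · rintro ⟨a, b⟩ h
      simp only [mem_filter, mem_product] at h ⊢
      refine ⟨h.1.1, ?_⟩
      rw [← h.2, add_sub_cancel_left]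
      exact h.1.2
    · rintro ⟨a, b⟩ h ⟨a', b'⟩ h' (rfl : a = a')
      simp only [mem_filter] at h h'
      rw [add_left_cancel (h.2.trans h'.2.symm)]
    · intro u hu
      simp only [mem_filter] at hu
      exact ⟨(u, s - u), by simp [hu.1, hu.2], rfl⟩
  have hbad : 2 * #{p ∈ A ×ˢ A | ¬ good (p.1 + p.2)} ≤ #A * #A := by
    have hmaps : Set.MapsTo (fun p : M × M => p.1 + p.2)
        ({p ∈ A ×ˢ A | ¬ good (p.1 + p.2)} : Finset (M × M))
        ({s ∈ A + A | ¬ good s} : Finset M) := by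
      intro p hp
      simp only [coe_filter, mem_product, Set.mem_ofPred_eq] at hp ⊢
      exact ⟨add_mem_add hp.1.1 hp.1.2, hp.2⟩
    have h1 : 2 * #(A + A) * #{p ∈ A ×ˢ A | ¬ good (p.1 + p.2)} ≤ #(A + A) * (#A * #A) := by
      rw [card_eq_sum_card_fiberwise hmaps, mul_sum]
      calc _ ≤ ∑ s ∈ A + A with ¬ good s, #A * #A := by
            refine sum_le_sum fun s hs => ?_
            have hs' := not_le.1 (mem_filter.1 hs).2
            refine le_trans ?_ hs'.le
            rw [← hrep]
            gcongr
            exact filter_subset _ _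
        _ ≤ _ := by
            rw [sum_const, smul_eq_mul]
            gcongr
            exact filter_subset _ _
    refine Nat.le_of_mul_le_mul_left ?_ hAA
    linarith
  have hgood : #A * #A ≤ 2 * #{p ∈ A ×ˢ A | good (p.1 + p.2)} := by
    have := card_filter_add_card_filter_not (s := A ×ˢ A) fun p => good (p.1 + p.2)
    rw [card_product] at this
    omega
  have hmaps : Set.MapsTo (fun p : M × M => p.2)
      ({p ∈ A ×ˢ A | good (p.1 + p.2)} : Finset (M × M)) (A : Set M) := by
    intro p hp
    simp only [coe_filter, mem_product, Set.mem_ofPred_eq] at hp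
    exact hp.1.2
  rw [card_eq_sum_card_fiberwise hmaps, mul_sum] at hgood
  obtain ⟨y, hy, hle⟩ := exists_le_of_sum_le (f := fun _ => #A) hA
    (((sum_const _).trans (smul_eq_mul _ _)).trans_le hgood)
  refine ⟨y, hy, {x ∈ A | good (x + y)}, filter_subset _ _, hle.trans ?_, ?_⟩
  · gcongr
    refine card_le_card_of_injOn Prod.fst ?_ ?_
    · rintro ⟨a, b⟩ h
      simp only [coe_filter, mem_filter, mem_product, Set.mem_ofPred_eq] at h ⊢
      obtain ⟨⟨h1, h2⟩, rfl⟩ := h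
      exact ⟨h1.1, h2⟩
    · rintro ⟨a, b⟩ h ⟨a', b'⟩ h' (rfl : a = a')
      simp only [coe_filter, mem_filter, Set.mem_ofPred_eq] at h h'
      rw [h.2, h'.2]
  · intro x hx
    exact (mem_filter.1 hx).2

/-! ### Coverings by translates of iterated difference sets -/

/-- `X` is covered by at most `N` translates of the iterated sum-difference set `m B - m B`. -/
def IsCoveredBy {M : Type*} [AddCommGroup M] [DecidableEq M] (B : Finset M) (m : ℕ) (N : ℝ)
    (X : Finset M) : Prop :=
  ∃ T : Finset M, (T.card : ℝ) ≤ N ∧ X ⊆ T + (m • B - m • B)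

section IsCoveredBy

open Finset

variable {M : Type*} [AddCommGroup M] [DecidableEq M] {B X Y : Finset M} {m n : ℕ} {N P : ℝ}

theorem IsCoveredBy.mono (hX : IsCoveredBy B m N X) (h : Y ⊆ X) : IsCoveredBy B m N Y := by
  obtain ⟨T, hT, hX⟩ := hX
  exact ⟨T, hT, h.trans hX⟩

theorem IsCoveredBy.add (hX : IsCoveredBy B m N X) (hY : IsCoveredBy B n P Y) :
    IsCoveredBy B (m + n) (N * P) (X + Y) := by
  obtain ⟨T, hT, hX⟩ := hX
  obtain ⟨U, hU, hY⟩ := hY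
  refine ⟨T + U, ?_, ?_⟩
  · calc ((#(T + U) : ℕ) : ℝ) ≤ (#T * #U : ℕ) := by exact_mod_cast card_add_le
      _ = #T * #U := by push_cast; ring
      _ ≤ _ := mul_le_mul hT hU (by positivity) ((Nat.cast_nonneg _).trans hT)
  · refine (add_subset_add hX hY).trans (subset_of_eq ?_)
    rw [add_nsmul, add_add_add_comm, add_sub_add_comm]

theorem IsCoveredBy.neg (hX : IsCoveredBy B m N X) : IsCoveredBy B m N (-X) := by
  obtain ⟨T, hT, hX⟩ := hX
  refine ⟨-T, by rwa [card_neg], ?_⟩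
  have := neg_subset_neg hX
  rwa [neg_add, neg_sub] at this

theorem IsCoveredBy.sub (hX : IsCoveredBy B m N X) (hY : IsCoveredBy B n P Y) :
    IsCoveredBy B (m + n) (N * P) (X - Y) := by
  rw [sub_eq_add_neg]
  exact hX.add hY.neg

theorem IsCoveredBy.card_le (hX : IsCoveredBy B m N X) : (#X : ℝ) ≤ N * #(m • B - m • B) := by
  obtain ⟨T, hT, hX⟩ := hX
  calc (#X : ℝ) ≤ (#T * #(m • B - m • B) : ℕ) := by
        exact_mod_cast (card_le_card hX).trans card_add_le
    _ = #T * #(m • B - m • B) := by push_cast; ring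
    _ ≤ _ := by gcongr

end IsCoveredBy

/-! ### A set whose sum with its squares is small -/

open Finset in
theorem card_nsmul_sub_nsmul_le {M : Type*} [AddCommGroup M] [DecidableEq M] {A : Finset M}
    (hA : A.Nonempty) (B : Finset M) {K : ℝ} (hK : (#(A + B) : ℝ) ≤ K * #A) (m n : ℕ) :
    (#(m • B - n • B) : ℝ) ≤ K ^ (m + n) * #A := by
  have h := pluennecke_ruzsa_inequality_nsmul_sub_nsmul_add hA B m n
  have h' : (#(m • B - n • B) : ℝ) ≤ (#(A + B) / #A : ℝ) ^ (m + n) * #A := by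
    simpa using (NNRat.cast_le (K := ℝ)).2 h
  have hpos : (0 : ℝ) < #A := by exact_mod_cast hA.card_pos
  refine h'.trans ?_
  gcongr
  rwa [div_le_iff₀ hpos]

open Finset in
theorem card_le_two_mul_card_image_sq {F : Type*} [Field F] [DecidableEq F] (A : Finset F) :
    #A ≤ 2 * #(A.image (· ^ 2)) := by
  refine card_le_mul_card_image (f := (· ^ 2)) A 2 fun b hb => ?_
  obtain ⟨a, -, rfl⟩ := mem_image.1 hb
  refine (card_le_card (t := {a, -a}) fun x hx => ?_).trans card_le_two
  simpa using sq_eq_sq_iff_eq_or_eq_neg.1 (mem_filter.1 hx).2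

open Finset in
/-- Plünnecke's inequality is applied with `B` as the base, which is why the loss in passing from
`A` to its set of squares enters. -/
theorem card_add_self_le {F : Type*} [Field F] [DecidableEq F] {A : Finset F}
    (hA : A.Nonempty) {K : ℝ} (hK : (#(A + A.image (· ^ 2)) : ℝ) ≤ K * #A) :
    (#(A + A) : ℝ) ≤ 2 * K ^ 2 * #A := by
  set B := A.image (· ^ 2) with hB
  have hBne : B.Nonempty := hA.image _
  have hapos : (0 : ℝ) < #A := by exact_mod_cast hA.card_pos
  have hbpos : (0 : ℝ) < #B := by exact_mod_cast hBne.card_pos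
  have hab : (#A : ℝ) ≤ 2 * #B := by exact_mod_cast card_le_two_mul_card_image_sq A
  have h := card_nsmul_sub_nsmul_le hBne A (K := K * #A / #B)
    (by rw [add_comm, div_mul_cancel₀ _ hbpos.ne']; exact hK) 2 0
  rw [zero_nsmul, sub_zero, two_nsmul] at h
  refine h.trans ?_
  have : (K * #A / #B) ^ (2 + 0) * #B = K ^ 2 * #A * (#A / #B) := by
    rw [add_zero]
    field_simp
  rw [this]
  have h2 : (#A / #B : ℝ) ≤ 2 := by rwa [div_le_iff₀ hbpos]
  nlinarith [mul_le_mul_of_nonneg_left h2 (by positivity : (0 : ℝ) ≤ K ^ 2 * #A)]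

open Finset in
/-- If `s` has many representations `s = u + v` with `u, v ∈ A`, then the identity
`2 s u - s ^ 2 = u ^ 2 - v ^ 2` puts a dilate of a large part of `A` into a translate of `B - B`,
where `B` consists of the squares of `A`; Ruzsa's covering lemma extends this to all of `A`. -/
theorem isCoveredBy_dilate_of_popular_sum {F : Type*} [Field F] [DecidableEq F] {A : Finset F}
    (hA : A.Nonempty) {K : ℝ} (hK : (#(A + A.image (· ^ 2)) : ℝ) ≤ K * #A) {s : F}
    (hs : #A * #A ≤ 2 * #(A + A) * #{u ∈ A | s - u ∈ A}) :
    IsCoveredBy (A.image (· ^ 2)) 2 (8 * K ^ 4) ((2 * s) • A) := by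
  set B := A.image (· ^ 2) with hB
  set P : Finset F := {u ∈ A | s - u ∈ A} with hP
  have hapos : (0 : ℝ) < #A := by exact_mod_cast hA.card_pos
  have hAA := card_add_self_le hA hK
  have hs' : (#A * #A : ℝ) ≤ 2 * #(A + A) * #P := by exact_mod_cast hs
  have hPA : (#A : ℝ) ≤ 4 * K ^ 2 * #P := by
    have : (#A * #A : ℝ) ≤ #A * (4 * K ^ 2 * #P) := by
      have := mul_le_mul_of_nonneg_right hAA (Nat.cast_nonneg #P : (0 : ℝ) ≤ #P)
      linarith
    exact le_of_mul_le_mul_left this hapos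
  have hPne : P.Nonempty := by
    rw [nonempty_iff_ne_empty]
    intro h
    rw [h] at hPA
    simp at hPA
    exact hA.ne_empty hPA
  have hAP : (#(A + P) : ℝ) ≤ 8 * K ^ 4 * #P := by
    calc (#(A + P) : ℝ) ≤ #(A + A) := by
          exact_mod_cast card_le_card (add_subset_add_left (filter_subset _ _))
      _ ≤ 2 * K ^ 2 * #A := hAA
      _ ≤ 2 * K ^ 2 * (4 * K ^ 2 * #P) := by gcongr
      _ = _ := by ring
  obtain ⟨T, -, hT, hcov⟩ := ruzsa_covering_add hPne hAP
  refine ⟨(2 * s) • T, le_trans (by exact_mod_cast card_image_le) hT, ?_⟩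
  intro z hz
  obtain ⟨a, ha, rfl⟩ := mem_smul_finset.1 hz
  obtain ⟨t, ht, w, hw, rfl⟩ := mem_add.1 (hcov ha)
  obtain ⟨u, hu, v, hv, rfl⟩ := mem_sub.1 hw
  simp only [hP, mem_filter] at hu hv
  have hsq : ∀ x ∈ A, x ^ 2 ∈ B := fun x hx => mem_image_of_mem _ hx
  refine mem_add.2 ⟨(2 * s) • t, smul_mem_smul_finset ht,
    (u ^ 2 + (s - v) ^ 2) - (v ^ 2 + (s - u) ^ 2), ?_, ?_⟩
  · rw [two_nsmul]
    exact sub_mem_sub (add_mem_add (hsq _ hu.1) (hsq _ hv.2))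
      (add_mem_add (hsq _ hv.1) (hsq _ hu.2))
  · simp only [smul_eq_mul]
    ring

/-! ### Growth of `A + A²` -/

open Finset in
theorem card_smul_add_smul {F : Type*} [Field F] [DecidableEq F] (A : Finset F) {q : F}
    (hq : q ≠ 0) (r : F) : #(q • A + (q * r) • A) = #(A + r • A) := by
  rw [mul_smul, ← smul_add, card_smul_finset₀ hq]

open Finset in
theorem card_add_smul_le_of_subset_add_singleton {F : Type*} [Field F] [DecidableEq F]
    {A Y : Finset F} {y : F} (hY : Y ⊆ A + {y}) (r : F) : #(Y + r • Y) ≤ #(A + r • A) := by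
  have hsub : Y + r • Y ⊆ (A + r • A) + {y + r * y} := by
    intro x hx
    obtain ⟨u, hu, _, hv, rfl⟩ := mem_add.1 hx
    obtain ⟨v, hv', rfl⟩ := mem_smul_finset.1 hv
    obtain ⟨a, ha, _, hy, rfl⟩ := mem_add.1 (hY hu)
    obtain ⟨b, hb, _, hy', rfl⟩ := mem_add.1 (hY hv')
    rw [mem_singleton.1 hy, mem_singleton.1 hy']
    exact mem_add.2 ⟨a + r • b, add_mem_add ha (smul_mem_smul_finset hb), _, mem_singleton_self _,
      by simp only [smul_eq_mul]; ring⟩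
  exact (card_le_card hsub).trans (card_add_le.trans (by simp))

open Finset in
theorem IsCoveredBy.dilate_add {F : Type*} [Field F] [DecidableEq F] {A B : Finset F} {m n : ℕ}
    {N P : ℝ} {s t : F} (hs : IsCoveredBy B m N (s • A)) (ht : IsCoveredBy B n P (t • A)) :
    IsCoveredBy B (m + n) (N * P) ((s + t) • A) := by
  refine (hs.add ht).mono fun x hx => ?_
  obtain ⟨a, ha, rfl⟩ := mem_smul_finset.1 hx
  rw [add_smul]
  exact add_mem_add (smul_mem_smul_finset ha) (smul_mem_smul_finset ha)

open Finset in
theorem IsCoveredBy.dilate_sub {F : Type*} [Field F] [DecidableEq F] {A B : Finset F} {m n : ℕ}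
    {N P : ℝ} {s t : F} (hs : IsCoveredBy B m N (s • A)) (ht : IsCoveredBy B n P (t • A)) :
    IsCoveredBy B (m + n) (N * P) ((s - t) • A) := by
  refine (hs.sub ht).mono fun x hx => ?_
  obtain ⟨a, ha, rfl⟩ := mem_smul_finset.1 hx
  rw [sub_smul]
  exact sub_mem_sub (smul_mem_smul_finset ha) (smul_mem_smul_finset ha)

open Finset in
/-- The quantitative form of the theorem: growth exponent `1 / 48` for `A + A²` in odd
characteristic. The hypothesis `hG` says that
`A + A` meets the dilate of a subfield `G` in at most `|G| ^ (1 / 2)` points. -/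
theorem card_le_mul_pow_of_card_add_image_sq_le {F : Type*} [Field F] [DecidableEq F] [Finite F]
    (h2 : (2 : F) ≠ 0) {A : Finset F} (hA : 2 < #A) {K : ℝ}
    (hK : (#(A + A.image (· ^ 2)) : ℝ) ≤ K * #A)
    (hG : ∀ (G : Subfield F) (t : F), t ≠ 0 → ∀ Y ⊆ A + A, (∀ y ∈ Y, ∃ g ∈ G, y = t * g) →
      #Y ^ 2 ≤ Nat.card G) :
    (#A : ℝ) ≤ 2 ^ 22 * K ^ 48 := by
  set B := A.image (· ^ 2) with hB
  have hAne : A.Nonempty := card_pos.1 (by omega)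
  have hapos : (0 : ℝ) < #A := by exact_mod_cast hAne.card_pos
  have hK1 : 1 ≤ K := by
    have h : #A ≤ #(A + B) := card_le_card_add_right (hAne.image _)
    have h' : (#A : ℝ) ≤ #(A + B) := by exact_mod_cast h
    exact le_of_mul_le_mul_right (by linarith) hapos
  obtain ⟨y, hy, A', hA', hcard, hpop⟩ := exists_translate_of_popular_sums A hAne
  set Y := A' + {y} with hYdef
  have hYA : Y ⊆ A + {y} := add_subset_add_right hA'
  have hYcard : #Y = #A' := by rw [hYdef, card_add_singleton]
  have hcov : ∀ s ∈ Y, IsCoveredBy B 2 (8 * K ^ 4) ((2 * s) • A) := by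
    intro s hs
    obtain ⟨x, hx, _, hy', rfl⟩ := mem_add.1 hs
    rw [mem_singleton.1 hy']
    exact isCoveredBy_dilate_of_popular_sum hAne hK (hpop x hx)
  have hB_le : ∀ m, (#(m • B - m • B) : ℝ) ≤ K ^ (m + m) * #A := fun m =>
    card_nsmul_sub_nsmul_le hAne B hK m m
  have hcov_le : ∀ {m : ℕ} {N : ℝ} {X : Finset F}, 0 ≤ N → IsCoveredBy B m N X →
      (#X : ℝ) ≤ N * (K ^ (m + m) * #A) := fun hN hX =>
    hX.card_le.trans (mul_le_mul_of_nonneg_left (hB_le _) hN)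
  -- Dilating with `2 q` clears the denominator of a quotient `r = e / q`.
  have hdil : ∀ {m n : ℕ} {N P : ℝ} {q e r : F}, q ≠ 0 → q * r = e → 0 ≤ N → 0 ≤ P →
      IsCoveredBy B m N ((2 * q) • A) → IsCoveredBy B n P ((2 * e) • A) →
      (#(Y + r • Y) : ℝ) ≤ N * P * (K ^ ((m + n) + (m + n)) * #A) := by
    intro m n N P q e r hq hqr hN hP h h'
    have h1 : #(Y + r • Y) ≤ #((2 * q) • A + (2 * e) • A) := by
      rw [← hqr, ← mul_assoc, card_smul_add_smul A (mul_ne_zero h2 hq)]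
      exact card_add_smul_le_of_subset_add_singleton hYA r
    have h1' : (#(Y + r • Y) : ℝ) ≤ #((2 * q) • A + (2 * e) • A) := by exact_mod_cast h1
    exact h1'.trans (hcov_le (mul_nonneg hN hP) (h.add h'))
  have hM : 0 ≤ 8 * K ^ 4 := by positivity
  have hM2 : 0 ≤ 8 * K ^ 4 * (8 * K ^ 4) := by positivity
  have hdiff : ∀ s ∈ Y, ∀ t ∈ Y,
      IsCoveredBy B (2 + 2) (8 * K ^ 4 * (8 * K ^ 4)) ((2 * (s - t)) • A) := by
    intro s hs t ht
    rw [mul_sub]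
    exact (hcov s hs).dilate_sub (hcov t ht)
  have hY1 : 1 < #Y := by omega
  obtain ⟨a, ha, b, hb, c, hc, d, hd, hcd, r, hr, hform⟩ :=
    exists_card_sq_le_two_mul_card_add_smul_of_differences hY1 fun G t ht h =>
      hG G t ht Y (add_subset_add hA' (singleton_subset_iff.2 hy)) h
  have hcd' : c - d ≠ 0 := sub_ne_zero.2 hcd
  have hquot : (#(Y + ((a - b) / (c - d)) • Y) : ℝ) ≤ 2 ^ 12 * K ^ 32 * #A := by
    have h := hdil hcd' (mul_div_cancel₀ (a - b) hcd') hM2 hM2 (hdiff c hc d hd) (hdiff a ha b hb)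
    refine h.trans (le_of_eq ?_)
    ring
  have hA_Y : (#A : ℝ) ≤ 2 * #Y := by rw [hYcard]; exact_mod_cast hcard
  have hpow : K ^ 32 ≤ K ^ 48 := pow_le_pow_right₀ hK1 (by norm_num)
  have hup : (#(Y + r • Y) : ℝ) ≤ 2 ^ 19 * K ^ 48 * #A := by
    have hKA : K ^ 32 * #A ≤ K ^ 48 * #A := by gcongr
    rcases hform with rfl | rfl | ⟨s, hs, t, ht, hs0, ht0, rfl⟩
    · nlinarith
    · have := hdil (r := 1 + (a - b) / (c - d)) hcd' rfl hM2 (mul_nonneg hM2 hM2)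
        (hdiff c hc d hd) (by
          rw [mul_add, mul_one, mul_div_cancel₀ _ hcd', mul_add]
          exact (hdiff c hc d hd).dilate_add (hdiff a ha b hb))
      refine this.trans ?_
      ring_nf
      nlinarith [mul_nonneg (by positivity : 0 ≤ K ^ 48) hapos.le]
    · -- Ruzsa's triangle inequality through `(s / t) • Y` avoids products of coefficients.
      have hst : s / t ≠ 0 := div_ne_zero hs0 ht0
      have htri := ruzsa_triangle_inequality_add_add_add Y ((s / t) • Y)
        ((s / t * ((a - b) / (c - d))) • Y)
      rw [card_smul_add_smul Y hst, card_smul_finset₀ hst] at htri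
      have htri' : (#(Y + (s / t * ((a - b) / (c - d))) • Y) * #Y : ℝ) ≤
          #(Y + (s / t) • Y) * #(Y + ((a - b) / (c - d)) • Y) := by exact_mod_cast htri
      have h1 := hdil ht0 (mul_div_cancel₀ s ht0) hM hM (hcov t ht) (hcov s hs)
      have hypos : (0 : ℝ) < #Y := by exact_mod_cast (by omega : 0 < #Y)
      refine le_of_mul_le_mul_right ?_ hypos
      calc _ ≤ _ := htri'
        _ ≤ (8 * K ^ 4 * (8 * K ^ 4) * (K ^ (2 + 2 + (2 + 2)) * #A)) *
            (2 ^ 12 * K ^ 32 * #A) := by gcongr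
        _ = 2 ^ 18 * K ^ 48 * #A * #A := by ring
        _ ≤ 2 ^ 18 * K ^ 48 * #A * (2 * #Y) := by gcongr
        _ = _ := by ring
  have hr' : (#Y ^ 2 : ℝ) ≤ 2 * #(Y + r • Y) := by exact_mod_cast hr
  refine le_of_mul_le_mul_right ?_ hapos
  calc (#A * #A : ℝ) ≤ (2 * #Y) * (2 * #Y) := by gcongr
    _ = 4 * (#Y ^ 2 : ℝ) := by ring
    _ ≤ 4 * (2 * (2 ^ 19 * K ^ 48 * #A)) := by linarith
    _ = _ := by ring

/-- In characteristic `2` the two-element prime field has an affine copy through any two points. -/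
theorem subsingleton_of_two_eq_zero {F : Type*} [Field F] [Finite F] (h2 : (2 : F) = 0)
    {S : Set F} (hS : ∀ a b : F, a ≠ 0 →
      ((S ∩ affineCopy ⊥ a b).ncard : ℝ) ≤ (Nat.card (⊥ : Subfield F) : ℝ) ^ (1 / 2 : ℝ)) :
    S.Subsingleton := by
  intro x hx y hy
  by_contra hxy
  have : CharP F 2 := CharTwo.of_one_ne_zero_of_two_eq_zero one_ne_zero h2
  have hcard : Nat.card (⊥ : Subfield F) = 2 := Subfield.card_bot F 2
  have h := hS (y - x) x (sub_ne_zero.2 (Ne.symm hxy))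
  rw [hcard, ← Real.sqrt_eq_rpow] at h
  have hsub : ({x, y} : Set F) ⊆ S ∩ affineCopy ⊥ (y - x) x := by
    rintro z (rfl | rfl)
    · exact ⟨hx, 0, zero_mem _, by simp⟩
    · exact ⟨hy, 1, one_mem _, by simp⟩
  have h3 := Set.ncard_le_ncard hsub (Set.toFinite _)
  rw [Set.ncard_pair hxy] at h3
  have h4 : (2 : ℝ) ≤ √(2 : ℕ) := le_trans (by exact_mod_cast h3) h
  have h5 := pow_le_pow_left₀ (by norm_num) h4 2
  rw [Real.sq_sqrt (Nat.cast_nonneg _)] at h5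
  norm_num at h5

theorem corollary1p3 :
    ∃ C : ℝ, 0 < C ∧
      ∀ (F : Type*) [Field F] [Finite F] (A : Set F),
        (∀ (G : Subfield F) (a b : F), a ≠ 0 →
          (((A + A) ∩ affineCopy G a b).ncard : ℝ) ≤ (Nat.card G : ℝ) ^ (1 / 2 : ℝ)) →
        C * (A.ncard : ℝ) ^ (1 + 1 / 84 : ℝ) ≤ ((A + squaresOf A).ncard : ℝ) := by
  refine ⟨1 / 2, by norm_num, fun F _ _ A hyp => ?_⟩
  classical
  obtain ⟨A, rfl⟩ := (Set.toFinite A).exists_finset_coe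
  have hsq : squaresOf (A : Set F) = ((A.image (· ^ 2) : Finset F) : Set F) := by
    ext x
    simp [squaresOf, eq_comm]
  rw [hsq, ← Finset.coe_add, Set.ncard_coe_finset, Set.ncard_coe_finset]
  rcases A.eq_empty_or_nonempty with rfl | hAne
  · rw [Finset.card_empty, Nat.cast_zero, Real.zero_rpow (by norm_num), mul_zero]
    exact Nat.cast_nonneg _
  have hapos : (0 : ℝ) < A.card := by exact_mod_cast hAne.card_pos
  have ha1 : (1 : ℝ) ≤ A.card := by exact_mod_cast hAne.card_pos
  set K : ℝ := (A + A.image (· ^ 2)).card / A.card with hKdef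
  have hK : ((A + A.image (· ^ 2)).card : ℝ) = K * A.card := (div_mul_cancel₀ _ hapos.ne').symm
  have hK1 : 1 ≤ K := by
    rw [hKdef, one_le_div hapos]
    exact_mod_cast Finset.card_le_card_add_right (hAne.image _)
  -- The constant `1 / 2` works because `2 ^ 84` dominates `2 ^ 22`; sets with at most two elements
  -- satisfy the bound trivially.
  have hmain : (A.card : ℝ) ≤ (2 * K) ^ 84 := by
    have hKpow : K ^ 48 ≤ K ^ 84 := pow_le_pow_right₀ hK1 (by norm_num)
    have hKone : 1 ≤ K ^ 48 := one_le_pow₀ hK1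
    have hsmall : (A.card : ℝ) ≤ 2 ^ 22 * K ^ 48 := by
      rcases le_or_gt A.card 2 with h | h
      · have : (A.card : ℝ) ≤ 2 := by exact_mod_cast h
        linarith
      by_cases h2 : (2 : F) = 0
      · have hss := subsingleton_of_two_eq_zero h2 (hyp ⊥)
        rw [← Finset.coe_add] at hss
        have h3 := Finset.card_le_one_iff_subsingleton_coe.2 hss.coe_sort
        have h4 : A.card ≤ (A + A).card := Finset.card_le_card_add_right hAne
        omega
      refine card_le_mul_pow_of_card_add_image_sq_le h2 h hK.le fun G t ht Y hY hYG => ?_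
      have h3 := hyp G t 0 ht
      rw [← Real.sqrt_eq_rpow] at h3
      have h4 : (Y.card : ℝ) ≤ √(Nat.card G) := by
        refine le_trans ?_ h3
        rw [← Set.ncard_coe_finset]
        refine Nat.cast_le.2 (Set.ncard_le_ncard (fun z hz => ?_) (Set.toFinite _))
        obtain ⟨g, hg, rfl⟩ := hYG z hz
        refine ⟨?_, g, hg, (add_zero _).symm⟩
        rw [← Finset.coe_add]
        exact hY hz
      have h5 := pow_le_pow_left₀ (Nat.cast_nonneg _) h4 2
      rw [Real.sq_sqrt (Nat.cast_nonneg _)] at h5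
      exact_mod_cast h5
    rw [mul_pow]
    nlinarith
  have hroot : (A.card : ℝ) ^ (1 / 84 : ℝ) ≤ 2 * K := by
    have h := Real.rpow_le_rpow hapos.le hmain (by norm_num : (0 : ℝ) ≤ ((84 : ℕ) : ℝ)⁻¹)
    have hK0 : 0 ≤ 2 * K := by linarith
    rw [Real.pow_rpow_inv_natCast hK0 (by decide), Nat.cast_ofNat] at h
    rwa [one_div]
  rw [Real.rpow_add hapos, Real.rpow_one, hK]
  nlinarith
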